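/- Notation. For $q\in[1,\infty)$ and a Banach space $Y$, $\ell_q(Y)$ is the Banach space of sequences $x\in Y^{\mathbb N}$ with $\|x\|_{Y,q}=\left(\sum_{n}\|x(n)\|_Y^q\right)^{1/q}<\infty$. For a sequence $(M_n,d_n)_{n\in\mathbb N}$ of separable complete metric spaces and $p\in[1,\infty)$, $E((M_n)_{n\in\mathbb N},p)$ is the equivalence relation on $\prod_{n}M_n$ (with the product topology) under which $x,y$ are equivalent iff $\sum_{n}d_n(x(n),y(n))^p<\infty$; if $M_n=M$ for all $n$ it is written $E(M,p)$. For equivalence relations $E,F$ on Polish spaces $P,Q$, $E\le_B F$ means that there is a Borel map $\theta:P\to Q$ such that $x\,E\,y\iff\theta(x)\,F\,\theta(y)$ for all $x,y\in P$. For $\alpha>0$, a metric space $(M,d)$ finitely Hölder$(\alpha)$ embeds into a metric space $(M',d')$ if there is $A>0$ such that for every finite subset $F\subseteq M$ there is a map $T_F:F\to M'$ with $$\frac1A\,d(u,v)^\alpha\le d'(T_F(u),T_F(v))\le A\,d(u,v)^\alpha\qquad(u,v\in F).$$ Theorem. Let $X,Y$ be separable Banach spaces (both real or both complex) and $p,q\in[1,\infty)$.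 The following conditions are equivalent: (1) $X$ finitely Hölder$(p/q)$ embeds into $\ell_q(Y)$; (2) for every sequence $(F_n)_{n\in\mathbb N}$ of finite subsets of $X$ (each with the metric of $X$), $E((F_n)_{n\in\mathbb N},p)\le_B E(Y,q)$. Consequently, if $E(X,p)\le_B E(Y,q)$, then $X$ finitely Hölder$(p/q)$ embeds into $\ell_q(Y)$. -/

import Mathlib

/-- `E` is Borel reducible to `F`: there is a Borel map `θ` with
`x E y ↔ θ x F θ y`. Both spaces carry their Borel σ-algebras. -/
def BorelReducible {α β : Type*} [TopologicalSpace α] [TopologicalSpace β]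
    (E : Setoid α) (F : Setoid β) : Prop :=
  ∃ θ : α → β, @Measurable α β (borel α) (borel β) θ ∧ ∀ x y : α, E x y ↔ F (θ x) (θ y)

/-- The equivalence relation `E((M_n)_n, p)` on `∏ n, M n`:
`x` and `y` are equivalent iff `∑ n, d_n(x(n), y(n)) ^ p < ∞`. -/
def seqEquiv (M : ℕ → Type*) [∀ n, MetricSpace (M n)] (p : ℝ) [hp : Fact (1 ≤ p)] :
    Setoid (∀ n, M n) where
  r x y := Summable fun n => dist (x n) (y n) ^ p
  iseqv :=
    { refl := fun x => by
        have h : p ≠ 0 := by linarith [hp.out]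
        simp [Real.zero_rpow h, summable_zero]
      symm := fun {x y} h => by simpa only [dist_comm] using h
      trans := fun {x y z} hxy hyz => by
        have hp0 : 0 ≤ p := by linarith [hp.out]
        refine Summable.of_nonneg_of_le (fun n => by positivity) (fun n => ?_)
          ((hxy.add hyz).mul_left ((2 : ℝ) ^ p))
        have ha : 0 ≤ dist (x n) (y n) ^ p := by positivity
        have hb : 0 ≤ dist (y n) (z n) ^ p := by positivity
        have ht := dist_triangle (x n) (y n) (z n)
        rcases le_total (dist (x n) (y n)) (dist (y n) (z n)) with h | h
        · calc dist (x n) (z n) ^ p ≤ (2 * dist (y n) (z n)) ^ p :=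
                Real.rpow_le_rpow dist_nonneg (by linarith) hp0
            _ = 2 ^ p * dist (y n) (z n) ^ p := Real.mul_rpow (by norm_num) dist_nonneg
            _ ≤ _ := by gcongr; linarith
        · calc dist (x n) (z n) ^ p ≤ (2 * dist (x n) (y n)) ^ p :=
                Real.rpow_le_rpow dist_nonneg (by linarith) hp0
            _ = 2 ^ p * dist (x n) (y n) ^ p := Real.mul_rpow (by norm_num) dist_nonneg
            _ ≤ _ := by gcongr; linarith }

/-- The space `M` finitely Hölder(`α`) embeds into `M'`: one constant `A` serves all
finite subsets of `M`. -/
def FinitelyHolderEmbeds (M M' : Type*) [MetricSpace M] [MetricSpace M'] (α : ℝ) : Prop :=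
  ∃ A : ℝ, 0 < A ∧ ∀ F : Finset M, ∃ T : F → M', ∀ u v : F,
    1 / A * dist u v ^ α ≤ dist (T u) (T v) ∧ dist (T u) (T v) ≤ A * dist u v ^ α

instance factOneLeOfReal (q : ℝ) [hq : Fact (1 ≤ q)] : Fact (1 ≤ ENNReal.ofReal q) :=
  ⟨ENNReal.one_le_ofReal.2 hq.out⟩

/-- The Banach space `ℓ_q(Y)` of `q`-summable sequences in `Y`. -/
abbrev EllSpace (q : ℝ) (Y : Type*) [NormedAddCommGroup Y] : Type _ :=
  lp (fun _ : ℕ => Y) (ENNReal.ofReal q)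

/-! If uniform Hölder maps `T n : F n → ℓ_q(Y)` exist, concatenating the sequences `T n (x n)` along
a bijection of ℕ × ℕ with ℕ gives a continuous reduction: the `q`-sum of block `n` is `‖T n (x n) -
T n (y n)‖ ^ q`, comparable to `dist (x n) (y n) ^ p` with constants independent of `n`.

For the converse, suppose no uniform constant exists. By scaling, for each `k` there is a finite `G
k ⊆ X` of diameter at most `2⁻ᵏ` on which every map to `ℓ_q(Y)` violates the bounds with constant
`4ᵏ`. Repeat each `G k` infinitely often to form `F`, and let `θ` be a Borel reduction. A Baire
category argument (`exists_generic_insensitive`, `exists_free_coordinates`) fixes all but infinitely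
many coordinates `n i`, so that up to a `q`-summable error the `i`-th block of `θ x` depends on `x
(n i)` alone. Each block is then a map `F (n i) → ℓ_q(Y)`, so some pair `u i, v i` is badly
distorted by it.

Since `θ` is a reduction, the `p`-th powers of the distances and the `q`-th powers of the image
distances are summable along the same index sets. Distortion by unbounded factors, each occurring
infinitely often, rules this out (`false_of_distorted_ratios`). -/

open Set Filter Topology TopologicalSpace

/-! ### Finite modifications and Baire category. -/

/-- The sequence that agrees with `x` below `m` and with `y` from `m` on. -/
def splice {Z : ℕ → Type*} (m : ℕ) (x y : ∀ n, Z n) : ∀ n, Z n :=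
  fun n => if n < m then x n else y n

lemma splice_of_lt {Z : ℕ → Type*} {m n : ℕ} (x y : ∀ n, Z n) (h : n < m) :
    splice m x y n = x n := if_pos h

lemma splice_of_le {Z : ℕ → Type*} {m n : ℕ} (x y : ∀ n, Z n) (h : m ≤ n) :
    splice m x y n = y n := if_neg (not_lt.2 h)

lemma splice_congr {Z : ℕ → Type*} {m : ℕ} {x x' : ∀ n, Z n} (y : ∀ n, Z n)
    (h : ∀ n < m, x n = x' n) : splice m x y = splice m x' y := by
  funext n
  rcases lt_or_ge n m with hn | hn
  · rw [splice_of_lt _ _ hn, splice_of_lt _ _ hn, h n hn]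
  · rw [splice_of_le _ _ hn, splice_of_le _ _ hn]

lemma continuous_splice {Z : ℕ → Type*} [∀ n, TopologicalSpace (Z n)] (m : ℕ) (x : ∀ n, Z n) :
    Continuous (splice m x) := by
  refine continuous_pi fun n => ?_
  unfold splice
  by_cases h : n < m
  · simpa [h] using continuous_const
  · simpa [h] using continuous_apply n

lemma exists_agree_subset_of_mem_nhds {Z : ℕ → Type*} [∀ n, TopologicalSpace (Z n)]
    [∀ n, DiscreteTopology (Z n)] {x : ∀ n, Z n} {V : Set (∀ n, Z n)} (hV : V ∈ 𝓝 x) :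
    ∃ M : ℕ, ∀ y : ∀ n, Z n, (∀ n < M, y n = x n) → y ∈ V := by
  obtain ⟨_, ⟨z, M, rfl⟩, hx, hsub⟩ :=
    (PiNat.isTopologicalBasis_cylinders Z).mem_nhds_iff.1 hV
  refine ⟨M, fun y hy => hsub fun n hn => ?_⟩
  rw [hy n hn, hx n hn]

lemma isOpen_setOf_agree {Z : ℕ → Type*} [∀ n, TopologicalSpace (Z n)]
    [∀ n, DiscreteTopology (Z n)] (x : ∀ n, Z n) (m : ℕ) :
    IsOpen {y : ∀ n, Z n | ∀ n < m, y n = x n} :=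
  PiNat.isOpen_cylinder Z x m

/-- Prescribing finitely many coordinates preserves genericity. -/
lemma dense_preimage_splice {Z : ℕ → Type*} [∀ n, TopologicalSpace (Z n)]
    [∀ n, DiscreteTopology (Z n)] {O : Set (∀ n, Z n)} (hd : Dense O) (m : ℕ) (r : ∀ n, Z n) :
    Dense (splice m r ⁻¹' O) := by
  rw [dense_iff_inter_open]
  rintro V hV ⟨g, hg⟩
  -- A point `z` of `O` that already begins like `r` is recovered after its beginning is replaced by
  -- that of `g` and then by that of `r`.
  obtain ⟨z, ⟨hzV, hzr⟩, hzO⟩ := hd.inter_open_nonempty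
    (splice m g ⁻¹' V ∩ {y | ∀ n < m, y n = r n})
    ((hV.preimage (continuous_splice m g)).inter (isOpen_setOf_agree r m))
    ⟨splice m r g, by
      constructor
      · have : splice m g (splice m r g) = g := by
          funext n; simp only [splice]; split_ifs <;> rfl
        simpa only [mem_preimage, this] using hg
      · intro n hn
        exact splice_of_lt _ _ hn⟩
  refine ⟨splice m g z, hzV, ?_⟩
  have : splice m r (splice m g z) = z := by
    funext n
    rcases lt_or_ge n m with hn | hn
    · rw [splice_of_lt _ _ hn, hzr n hn]
    · rw [splice_of_le _ _ hn, splice_of_le _ _ hn]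
  simpa only [mem_preimage, this] using hzO

/-- Countably many Borel sets in a product of finite discrete spaces are relatively open in a
`Gδ` set that contains all finite modifications of one of its points. -/
lemma exists_generic_point {Z : ℕ → Type*} [∀ n, TopologicalSpace (Z n)]
    [∀ n, DiscreteTopology (Z n)] [∀ n, Finite (Z n)] [∀ n, Nonempty (Z n)]
    [MeasurableSpace (∀ n, Z n)] [BorelSpace (∀ n, Z n)] {ι : Type*} [Countable ι]
    (S : ι → Set (∀ n, Z n)) (hS : ∀ i, MeasurableSet (S i)) :
    ∃ (g : ∀ n, Z n) (O : ℕ → Set (∀ n, Z n)), (∀ j, IsOpen (O j)) ∧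
      (∀ m r j, splice m r g ∈ O j) ∧
      ∀ i, ∃ U, IsOpen U ∧ ∀ x, (∀ j, x ∈ O j) → (x ∈ S i ↔ x ∈ U) := by
  -- Borel sets have the Baire property: each is open modulo a meager set.
  choose U hU hSU using fun i => (hS i).residualEq_isOpen
  have hW : {x | ∀ i, x ∈ S i ↔ x ∈ U i} ∈ residual (∀ n, Z n) :=
    eventually_countable_forall.2 fun i => (hSU i).mem_iff
  obtain ⟨t, htW, htG, htd⟩ := mem_residual.1 hW
  obtain ⟨O, hO, rfl⟩ := isGδ_iff_eq_iInter_nat.1 htG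
  -- Only the first `m` terms of the prescribed point matter and a dense sequence realises all of
  -- them, so countably many dense open conditions suffice.
  have key : ∀ᶠ g in residual (∀ n, Z n), ∀ a m j, splice m (denseSeq (∀ n, Z n) a) g ∈ O j := by
    refine eventually_countable_forall.2 fun a => eventually_countable_forall.2 fun m =>
      eventually_countable_forall.2 fun j => ?_
    exact residual_of_dense_open ((hO j).preimage (continuous_splice m _))
      (dense_preimage_splice (htd.mono (iInter_subset _ j)) m _)
  obtain ⟨g, hg⟩ := (dense_of_mem_residual key).nonempty
  refine ⟨g, O, hO, fun m r j => ?_, fun i => ⟨U i, hU i, fun x hx => htW (mem_iInter.2 hx) i⟩⟩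
  obtain ⟨a, ha⟩ := (denseRange_denseSeq (∀ n, Z n)).exists_mem_open (isOpen_setOf_agree r m)
    ⟨r, fun _ _ => rfl⟩
  rw [← splice_congr g ha]
  exact hg a m j

/-- There are only finitely many initial segments of length `m`, so the largest of their thresholds
works for all of them. -/
lemma exists_uniform_of_finite_coordinates {Z : ℕ → Type*} [∀ n, Finite (Z n)]
    [hne : ∀ n, Nonempty (Z n)] (m : ℕ) (Q : (∀ n, Z n) → ℕ → Prop)
    (hmono : ∀ x M M', M ≤ M' → Q x M → Q x M')
    (hdep : ∀ x x' M, (∀ n < m, x n = x' n) → Q x M → Q x' M)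
    (h : ∀ x, ∃ M, Q x M) : ∃ M, ∀ x, Q x M := by
  classical
  choose f hf using h
  let e : (∀ i : Fin m, Z i) → ∀ n, Z n :=
    fun r n => if hn : n < m then r ⟨n, hn⟩ else (hne n).some
  obtain ⟨M, hM⟩ := (Set.finite_range fun r => f (e r)).bddAbove
  refine ⟨M, fun x => ?_⟩
  refine hdep (e fun i => x i) x M (fun n hn => by simp [e, hn]) ?_
  exact hmono _ _ _ (hM ⟨fun i => x i, rfl⟩) (hf _)

/-! ### Behaviour of a Borel map near a generic point, and free coordinates. -/

lemma dist_rpow_le_two_rpow_mul_add {Y : Type*} [PseudoMetricSpace Y] {q : ℝ} (hq : 0 ≤ q)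
    (a b c : Y) : dist a c ^ q ≤ 2 ^ q * (dist a b ^ q + dist b c ^ q) := by
  have h1 : 0 ≤ dist a b ^ q := by positivity
  have h2 : 0 ≤ dist b c ^ q := by positivity
  have ht := dist_triangle a b c
  rcases le_total (dist a b) (dist b c) with h | h
  · calc dist a c ^ q ≤ (2 * dist b c) ^ q := Real.rpow_le_rpow dist_nonneg (by linarith) hq
      _ = 2 ^ q * dist b c ^ q := Real.mul_rpow (by norm_num) dist_nonneg
      _ ≤ _ := by gcongr; linarith
  · calc dist a c ^ q ≤ (2 * dist a b) ^ q := Real.rpow_le_rpow dist_nonneg (by linarith) hq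
      _ = 2 ^ q * dist a b ^ q := Real.mul_rpow (by norm_num) dist_nonneg
      _ ≤ _ := by gcongr; linarith

/-- A Borel map on a product of finite spaces that sends eventually equal sequences to
`q`-summably close ones has a generic point near which it is, up to small errors, insensitive
to early coordinates in its tail and to late coordinates in its initial segment. -/
lemma exists_generic_insensitive {Z : ℕ → Type*} [∀ n, TopologicalSpace (Z n)]
    [∀ n, DiscreteTopology (Z n)] [∀ n, Finite (Z n)] [∀ n, Nonempty (Z n)]
    [MeasurableSpace (∀ n, Z n)] [BorelSpace (∀ n, Z n)]
    {Y : Type*} [MetricSpace Y] [SecondCountableTopology Y] [MeasurableSpace Y] [BorelSpace Y]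
    {q : ℝ} (hq : 0 < q) (θ : (∀ n, Z n) → ℕ → Y) (hθ : ∀ k, Measurable fun x => θ x k)
    (hsum : ∀ x y : ∀ n, Z n, (∃ m, ∀ n, m ≤ n → x n = y n) →
      Summable fun k => dist (θ x k) (θ y k) ^ q) (ε : ℕ → ℝ) (hε : ∀ j, 0 < ε j) :
    ∃ (g : ∀ n, Z n) (O : ℕ → Set (∀ n, Z n)), ∀ j m l, ∃ L, l < L ∧ ∃ M, m ≤ M ∧
      (∀ r x, (∀ n < M, x n = splice m r g n) → x ∈ O j) ∧
      (∀ r r' x, (∀ i, x ∈ O i) → (∀ n < M, x n = g n) →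
        ∀ N, ∑ k ∈ Finset.Ico L N, dist (θ (splice m r x) k) (θ (splice m r' x) k) ^ q ≤ ε j) ∧
      (∀ r x, (∀ i, x ∈ O i) → (∀ n < M, x n = splice m r g n) →
        ∑ k ∈ Finset.range L, dist (θ x k) (θ (splice m r g) k) ^ q ≤ ε j) := by
  classical
  let D := denseSeq (∀ n, Z n)
  -- The first family makes small tails an open condition on the generic set; the second makes every
  -- coordinate of `θ` continuous there.
  let S : (ℕ × ℕ × ℕ × ℕ × ℕ) ⊕ (ℕ × countableBasis Y) → Set (∀ n, Z n) := Sum.elim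
    (fun c => {x | ∀ N, ∑ k ∈ Finset.Ico c.1 N, dist (θ (splice c.2.1 (D c.2.2.1) x) k)
      (θ (splice c.2.1 (D c.2.2.2.1) x) k) ^ q ≤ ε c.2.2.2.2})
    (fun c => {x | θ x c.1 ∈ (c.2 : Set Y)})
  have hmod : ∀ m r k, Measurable fun x => θ (splice m r x) k := fun m r k =>
    (hθ k).comp (continuous_splice m r).measurable
  have hS : ∀ c, MeasurableSet (S c) := by
    rintro (⟨l, m, a, b, j⟩ | ⟨k, b⟩)
    · simp only [S, Sum.elim_inl, ofPred_forall]
      refine MeasurableSet.iInter fun N => measurableSet_le ?_ measurable_const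
      exact Finset.measurable_sum _ fun k _ => ((hmod m _ k).dist (hmod m _ k)).pow_const q
    · exact hθ k (isOpen_of_mem_countableBasis b.2).measurableSet
  obtain ⟨g, O, hO, hgO, hU⟩ := exists_generic_point S hS
  have hg : ∀ j, g ∈ O j := fun j => by
    have h := hgO 0 g j
    have e : splice 0 g g = g := by funext n; simp [splice]
    rwa [e] at h
  have hnhds : ∀ c x, (∀ j, x ∈ O j) → x ∈ S c → ∃ V ∈ 𝓝 x, ∀ y ∈ V, (∀ j, y ∈ O j) → y ∈ S c := by
    intro c x hx hxS
    obtain ⟨U, hUo, hUS⟩ := hU c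
    exact ⟨U, hUo.mem_nhds ((hUS x hx).1 hxS), fun y hy hyO => (hUS y hyO).2 hy⟩
  refine ⟨g, O, fun j m l => ?_⟩
  have hopen : ∃ M, ∀ r x, (∀ n < M, x n = splice m r g n) → x ∈ O j := by
    apply exists_uniform_of_finite_coordinates m
    · exact fun r M M' hM h x hx => h x fun n hn => hx n (hn.trans_le hM)
    · intro r r' M hr h x hx
      rw [← splice_congr g hr] at hx
      exact h x hx
    · exact fun r => exists_agree_subset_of_mem_nhds ((hO j).mem_nhds (hgO m r j))
  have htail : ∃ M, ∀ r r' x, (∀ i, x ∈ O i) → (∀ n < M, x n = g n) →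
      ∀ N, ∑ k ∈ Finset.Ico M N, dist (θ (splice m r x) k) (θ (splice m r' x) k) ^ q ≤ ε j := by
    have hmono : ∀ (r r' : ∀ n, Z n) (M M' : ℕ), M ≤ M' →
        (∀ x, (∀ i, x ∈ O i) → (∀ n < M, x n = g n) → ∀ N, ∑ k ∈ Finset.Ico M N,
          dist (θ (splice m r x) k) (θ (splice m r' x) k) ^ q ≤ ε j) →
        ∀ x, (∀ i, x ∈ O i) → (∀ n < M', x n = g n) → ∀ N, ∑ k ∈ Finset.Ico M' N,
          dist (θ (splice m r x) k) (θ (splice m r' x) k) ^ q ≤ ε j := by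
      intro r r' M M' hM h x hx hxg N
      refine le_trans ?_ (h x hx (fun n hn => hxg n (hn.trans_le hM)) N)
      exact Finset.sum_le_sum_of_subset_of_nonneg (Finset.Ico_subset_Ico_left hM)
        fun _ _ _ => by positivity
    apply exists_uniform_of_finite_coordinates m
    · exact fun r M M' hM h r' => hmono r r' M M' hM (h r')
    · intro r r₁ M hr h r' x hx hxg N
      rw [← splice_congr x hr]
      exact h r' x hx hxg N
    intro r
    apply exists_uniform_of_finite_coordinates m
    · exact fun r' M M' hM h => hmono r r' M M' hM h
    · intro r' r₁ M hr h x hx hxg N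
      rw [← splice_congr x hr]
      exact h x hx hxg N
    intro r'
    have hdense : ∀ r : ∀ n, Z n, ∃ a, ∀ n < m, D a n = r n := fun r =>
      (denseRange_denseSeq (∀ n, Z n)).exists_mem_open (isOpen_setOf_agree r m)
        ⟨r, fun _ _ => rfl⟩
    obtain ⟨a, ha⟩ := hdense r
    obtain ⟨b, hb⟩ := hdense r'
    -- The two modifications of `g` are eventually equal, so some tail is small at `g`; relative
    -- openness carries this to generic points near `g`.
    have hs := hsum (splice m r g) (splice m r' g)
      ⟨m, fun n hn => by rw [splice_of_le _ _ hn, splice_of_le _ _ hn]⟩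
    obtain ⟨s, hs⟩ := summable_iff_vanishing_norm.1 hs (ε j) (hε j)
    obtain ⟨L, hL⟩ := s.bddAbove
    have hgS : g ∈ S (Sum.inl (L + 1, m, a, b, j)) := by
      intro N
      simp only [splice_congr g ha, splice_congr g hb]
      refine (le_abs_self _).trans (hs _ ?_).le
      rw [Finset.disjoint_left]
      intro k hk hks
      have := hL hks
      have := (Finset.mem_Ico.1 hk).1
      omega
    obtain ⟨V, hV, hVS⟩ := hnhds _ g hg hgS
    obtain ⟨M, hM⟩ := exists_agree_subset_of_mem_nhds hV
    refine ⟨max M (L + 1), hmono r r' (max M (L + 1)) _ le_rfl fun x hx hxg N => ?_⟩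
    have h := hVS x (hM x fun n hn => hxg n (hn.trans_le (le_max_left _ _))) hx N
    simp only [splice_congr x ha, splice_congr x hb] at h
    exact (Finset.sum_le_sum_of_subset_of_nonneg
      (Finset.Ico_subset_Ico_left (le_max_right _ _)) fun _ _ _ => by positivity).trans h
  have hnear : ∀ L, ∃ M, ∀ r x, (∀ i, x ∈ O i) → (∀ n < M, x n = splice m r g n) →
      ∑ k ∈ Finset.range L, dist (θ x k) (θ (splice m r g) k) ^ q ≤ ε j := by
    intro L
    apply exists_uniform_of_finite_coordinates m
    · exact fun r M M' hM h x hx hxg => h x hx fun n hn => hxg n (hn.trans_le hM)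
    · intro r r' M hr h
      rwa [← splice_congr g hr]
    intro r
    have hc : ∀ k, ContinuousWithinAt (fun x => θ x k) {x | ∀ i, x ∈ O i} (splice m r g) := by
      intro k
      refine ((isBasis_countableBasis Y).nhds_hasBasis).tendsto_right_iff.2 ?_
      rintro b ⟨hb, hbx⟩
      obtain ⟨V, hV, hVS⟩ := hnhds (Sum.inr (k, ⟨b, hb⟩)) _ (hgO m r) hbx
      filter_upwards [mem_nhdsWithin_of_mem_nhds hV, self_mem_nhdsWithin] with x hxV hxO
      exact hVS x hxV hxO
    have hc' : Tendsto (fun x => ∑ k ∈ Finset.range L, dist (θ x k) (θ (splice m r g) k) ^ q)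
        (𝓝[{x | ∀ i, x ∈ O i}] (splice m r g)) (𝓝 0) := by
      have : (0 : ℝ) = ∑ k ∈ Finset.range L, (0 : ℝ) := by simp
      rw [this]
      refine tendsto_finsetSum _ fun k _ => ?_
      have h1 := (tendsto_iff_dist_tendsto_zero.1 (hc k)).rpow_const (Or.inr hq.le)
      rwa [Real.zero_rpow hq.ne'] at h1
    have h2 := eventually_nhdsWithin_iff.1 (hc'.eventually (gt_mem_nhds (hε j)))
    obtain ⟨M, hM⟩ := exists_agree_subset_of_mem_nhds h2
    exact ⟨M, fun x hx hxg => (hM x hxg hx).le⟩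
  obtain ⟨M₁, h₁⟩ := hopen
  obtain ⟨M₂, h₂⟩ := htail
  -- The cut-off `L` is fixed before the agreement length `M`, because the continuity estimate on
  -- the first `L` terms depends on `L`.
  obtain ⟨M₃, h₃⟩ := hnear (max M₂ (l + 1))
  refine ⟨max M₂ (l + 1), lt_of_lt_of_le (Nat.lt_succ_self l) (le_max_right _ _),
    max (max M₁ M₂) (max M₃ m), by simp, ?_, ?_, ?_⟩
  · exact fun r x hx => h₁ r x fun n hn => hx n (by omega)
  · intro r r' x hx hxg N
    refine le_trans ?_ (h₂ r r' x hx (fun n hn => hxg n (by omega)) N)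
    exact Finset.sum_le_sum_of_subset_of_nonneg (Finset.Ico_subset_Ico_left (le_max_left _ _))
      fun _ _ _ => by positivity
  · exact fun r x hx hxg => h₃ r x hx fun n hn => hxg n (by omega)

/-- Along suitable free coordinates `n i`, with all the others fixed, a Borel map that sends
eventually equal sequences to `q`-summably close ones splits, up to a `q`-summable error,
into blocks each depending on a single free coordinate. -/
theorem exists_free_coordinates {Z : ℕ → Type*} [∀ n, TopologicalSpace (Z n)]
    [∀ n, DiscreteTopology (Z n)] [∀ n, Finite (Z n)] [∀ n, Nonempty (Z n)]
    [MeasurableSpace (∀ n, Z n)] [BorelSpace (∀ n, Z n)]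
    {Y : Type*} [MetricSpace Y] [SecondCountableTopology Y] [MeasurableSpace Y] [BorelSpace Y]
    {q : ℝ} (hq : 0 < q) (θ : (∀ n, Z n) → ℕ → Y) (hθ : ∀ k, Measurable fun x => θ x k)
    (hsum : ∀ x y : ∀ n, Z n, (∃ m, ∀ n, m ≤ n → x n = y n) →
      Summable fun k => dist (θ x k) (θ y k) ^ q)
    (τ : ℕ → ℕ → Prop) (hτ : ∀ i M, ∃ n, M ≤ n ∧ τ i n) :
    ∃ (g : ∀ n, Z n) (n l : ℕ → ℕ), StrictMono n ∧ StrictMono l ∧ l 0 = 0 ∧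
      (∀ i, τ i (n i)) ∧ ∀ x : ∀ n, Z n, (∀ m, m ∉ range n → x m = g m) →
        Summable fun i => ∑ k ∈ Finset.Ico (l i) (l (i + 1)),
          dist (θ x k) (θ (Function.update g (n i) (x (n i))) k) ^ q := by
  classical
  obtain ⟨g, O, hstep⟩ := exists_generic_insensitive hq θ hθ hsum (fun j => (1 / 2 : ℝ) ^ j)
    fun j => by positivity
  choose L hL M hM hA hB hC using hstep
  choose pick hpick hpickτ using hτ
  -- `s i` is the pair (free coordinate, start of block `i`). Stage `i` applies the insensitivity
  -- lemma with `m` just past the current free coordinate, and the next free coordinate lies beyond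
  -- the resulting `M`.
  let s : ℕ → ℕ × ℕ := fun i => Nat.rec (pick 0 0, 0)
    (fun i s => (pick (i + 1) (M i (s.1 + 1) s.2), L i (s.1 + 1) s.2)) i
  have hs1 : ∀ i, M i ((s i).1 + 1) (s i).2 ≤ (s (i + 1)).1 := fun i => hpick _ _
  have hs2 : ∀ i, (s (i + 1)).2 = L i ((s i).1 + 1) (s i).2 := fun i => rfl
  have hn : StrictMono fun i => (s i).1 := strictMono_nat_of_lt_succ fun i =>
    (Nat.lt_succ_self _).trans_le ((hM i ((s i).1 + 1) (s i).2).trans (hs1 i))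
  have hl : StrictMono fun i => (s i).2 := strictMono_nat_of_lt_succ fun i => by
    rw [hs2]; exact hL _ _ _
  refine ⟨g, fun i => (s i).1, fun i => (s i).2, hn, hl, rfl, fun i => ?_, fun x hx => ?_⟩
  · cases i with
    | zero => exact hpickτ _ _
    | succ i => exact hpickτ _ _
  have hgap : ∀ i k, (s i).1 < k → k < (s (i + 1)).1 → k ∉ range fun i => (s i).1 := by
    rintro i k h1 h2 ⟨j, rfl⟩
    have : i < j := hn.lt_iff_lt.1 h1
    have : j < i + 1 := hn.lt_iff_lt.1 h2
    omega
  have hgap0 : ∀ k, k < (s 0).1 → k ∉ range fun i => (s i).1 := by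
    rintro k h1 ⟨j, rfl⟩
    exact absurd (hn.lt_iff_lt.1 h1) (Nat.not_lt_zero _)
  have hagree : ∀ y : ∀ n, Z n, (∀ m, m ∉ (range fun i => (s i).1) → y m = g m) →
      ∀ i, ∀ k < (s (i + 1)).1, y k = splice ((s i).1 + 1) y g k := by
    intro y hy i k hk
    rcases lt_or_ge k ((s i).1 + 1) with h | h
    · rw [splice_of_lt _ _ h]
    · rw [splice_of_le _ _ h, hy k (hgap i k h hk)]
  have hmem : ∀ y : ∀ n, Z n, (∀ m, m ∉ (range fun i => (s i).1) → y m = g m) →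
      ∀ i, y ∈ O i := fun y hy i =>
    hA i _ _ y y fun k hk => hagree y hy i k (hk.trans_le (hs1 i))
  have hbound : ∀ i, ∑ k ∈ Finset.Ico (s i).2 (s (i + 1)).2,
      dist (θ x k) (θ (Function.update g (s i).1 (x (s i).1)) k) ^ q
        ≤ 2 ^ q * 3 * (1 / 2 : ℝ) ^ i := by
    intro i
    set z := Function.update g (s i).1 (x (s i).1) with hz
    have hzg : ∀ k, k ≠ (s i).1 → z k = g k := fun k hk => Function.update_of_ne hk _ _
    have hzx : z (s i).1 = x (s i).1 := Function.update_self _ _ _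
    have hzO : ∀ j, z ∈ O j := hmem z fun m hm => hzg m fun h => hm ⟨i, h.symm⟩
    -- The intermediate point `w` forgets the later free coordinates of `x` (controlled by `hC`);
    -- passing from `w` to `z` forgets the earlier ones (controlled by `hB` of the previous stage,
    -- whence the error `2 * (1 / 2) ^ i`).
    set w := splice ((s i).1 + 1) x g with hw
    have h1 : ∑ k ∈ Finset.Ico (s i).2 (s (i + 1)).2, dist (θ x k) (θ w k) ^ q
        ≤ (1 / 2 : ℝ) ^ i := by
      refine le_trans (Finset.sum_le_sum_of_subset_of_nonneg ?_ fun _ _ _ => by positivity)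
        (hC i ((s i).1 + 1) (s i).2 x x (hmem x hx)
          fun k hk => hagree x hx i k (hk.trans_le (hs1 i)))
      intro k hk
      exact Finset.mem_range.2 (Finset.mem_Ico.1 hk).2
    have h2 : ∑ k ∈ Finset.Ico (s i).2 (s (i + 1)).2, dist (θ w k) (θ z k) ^ q
        ≤ 2 * (1 / 2 : ℝ) ^ i := by
      -- At stage zero there are no earlier free coordinates, so `w = z`.
      rcases i with _ | j
      · have : w = z := by
          funext k
          rcases lt_trichotomy k (s 0).1 with h | h | h
          · rw [hw, splice_of_lt _ _ (by omega), hx k (hgap0 k h), hzg k h.ne]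
          · subst h; rw [hw, splice_of_lt _ _ (by omega), hzx]
          · rw [hw, splice_of_le _ _ h, hzg k h.ne']
        simp [this, Real.zero_rpow hq.ne']
      · have hjn : (s j).1 + 1 ≤ (s (j + 1)).1 := hn (Nat.lt_succ_self j)
        have e1 : splice ((s j).1 + 1) x z = w := by
          funext k
          rcases lt_or_ge k ((s j).1 + 1) with h | h
          · rw [splice_of_lt _ _ h, hw, splice_of_lt _ _ (by omega)]
          rw [splice_of_le _ _ h]
          rcases lt_trichotomy k (s (j + 1)).1 with h' | h' | h'
          · rw [hw, splice_of_lt _ _ (by omega), hx k (hgap j k h h'), hzg k h'.ne]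
          · subst h'; rw [hw, splice_of_lt _ _ (by omega), hzx]
          · rw [hw, splice_of_le _ _ h', hzg k h'.ne']
        have e2 : splice ((s j).1 + 1) g z = z := by
          funext k
          rcases lt_or_ge k ((s j).1 + 1) with h | h
          · rw [splice_of_lt _ _ h, hzg k (by omega)]
          · rw [splice_of_le _ _ h]
        have h := hB j ((s j).1 + 1) (s j).2 x g z hzO
          (fun k hk => hzg k (hk.trans_le (hs1 j)).ne) (s (j + 1 + 1)).2
        rw [e1, e2] at h
        refine (h.trans_eq ?_)
        rw [pow_succ]; ring
    calc ∑ k ∈ Finset.Ico (s i).2 (s (i + 1)).2, dist (θ x k) (θ z k) ^ q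
        ≤ ∑ k ∈ Finset.Ico (s i).2 (s (i + 1)).2,
          2 ^ q * (dist (θ x k) (θ w k) ^ q + dist (θ w k) (θ z k) ^ q) :=
          Finset.sum_le_sum fun k _ => dist_rpow_le_two_rpow_mul_add hq.le _ _ _
      _ = 2 ^ q * (∑ k ∈ Finset.Ico (s i).2 (s (i + 1)).2, dist (θ x k) (θ w k) ^ q +
          ∑ k ∈ Finset.Ico (s i).2 (s (i + 1)).2, dist (θ w k) (θ z k) ^ q) := by
          rw [← Finset.mul_sum, Finset.sum_add_distrib]
      _ ≤ 2 ^ q * ((1 / 2 : ℝ) ^ i + 2 * (1 / 2 : ℝ) ^ i) := by gcongr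
      _ = _ := by ring
  exact Summable.of_nonneg_of_le (fun i => Finset.sum_nonneg fun _ _ => by positivity) hbound
    (summable_geometric_two.mul_left _)

/-! ### Index sets that separate two series. -/

/-- Indices are added until the sum of `a` first reaches 1, which happens because the terms are at
least `c`. Before the last index the sum of `a` is below 1, so that of `b` is at most `δ`; the last
term adds at most another `δ`. -/
lemma exists_finset_sum_bounds {J : Set ℕ} (hJ : J.Infinite) {a b : ℕ → ℝ} {c δ K : ℝ}
    (hc : 0 < c) (hδ : 0 ≤ δ) (hK : 1 ≤ K * δ) (ha : ∀ i ∈ J, c ≤ a i)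
    (hb : ∀ i ∈ J, b i ≤ δ) (hab : ∀ i ∈ J, K * b i ≤ a i) :
    ∃ S : Finset ℕ, (S : Set ℕ) ⊆ J ∧ 1 ≤ ∑ i ∈ S, a i ∧ ∑ i ∈ S, b i ≤ 2 * δ := by
  classical
  let e := hJ.natEmbedding
  have he : ∀ j, (e j : ℕ) ∈ J := fun j => (e j).2
  have hinj : Function.Injective fun j => (e j : ℕ) := Subtype.val_injective.comp e.injective
  have hex : ∃ m, 1 ≤ ∑ j ∈ Finset.range m, a (e j) := by
    obtain ⟨m, hm⟩ := exists_nat_gt (1 / c)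
    refine ⟨m, ?_⟩
    calc (1 : ℝ) ≤ m * c := by rw [div_lt_iff₀ hc] at hm; exact hm.le
      _ = ∑ j ∈ Finset.range m, c := by simp
      _ ≤ _ := Finset.sum_le_sum fun j _ => ha _ (he j)
  have hmap : ∀ f : ℕ → ℝ, ∑ i ∈ (Finset.range (Nat.find hex)).image (fun j => (e j : ℕ)), f i =
      ∑ j ∈ Finset.range (Nat.find hex), f (e j) := fun f =>
    Finset.sum_image fun _ _ _ _ h => hinj h
  refine ⟨(Finset.range (Nat.find hex)).image fun j => (e j : ℕ), ?_, ?_, ?_⟩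
  · intro i hi
    obtain ⟨j, _, rfl⟩ := Finset.mem_image.1 (Finset.mem_coe.1 hi)
    exact he j
  · rw [hmap]
    exact Nat.find_spec hex
  · rw [hmap]
    obtain ⟨m, hm⟩ : ∃ m, Nat.find hex = m + 1 := by
      refine Nat.exists_eq_succ_of_ne_zero fun h => ?_
      have := Nat.find_spec hex
      rw [h] at this
      norm_num at this
    have hlt : ∑ j ∈ Finset.range m, a (e j) < 1 :=
      not_le.1 (Nat.find_min hex (by omega))
    rw [hm, Finset.sum_range_succ]
    have h1 : K * ∑ j ∈ Finset.range m, b (e j) ≤ ∑ j ∈ Finset.range m, a (e j) := by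
      rw [Finset.mul_sum]
      exact Finset.sum_le_sum fun j _ => hab _ (he j)
    have h2 : ∑ j ∈ Finset.range m, b (e j) ≤ δ := by
      by_contra h
      nlinarith
    linarith [hb _ (he m)]

lemma existsUnique_mem_fiber {α β : Type*} (κ : α → β) (i : α) : ∃! k, i ∈ κ ⁻¹' {k} :=
  ⟨κ i, rfl, fun _ h => (mem_singleton_iff.1 h).symm⟩

/-- If `a` dominates `b` by unbounded factors along infinitely many infinite fibers of `κ`, some
set of indices makes the sum of `b` converge and the sum of `a` diverge. -/
lemma exists_set_summable_not_summable (κ : ℕ → ℕ) {a b : ℕ → ℝ} (ha0 : ∀ i, 0 ≤ a i)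
    (hb0 : ∀ i, 0 ≤ b i) {B : Set ℕ} (hB : B.Infinite) (J : ℕ → Set ℕ)
    (hJκ : ∀ k ∈ B, ∀ i ∈ J k, κ i = k) (hJ : ∀ k ∈ B, (J k).Infinite) (c : ℕ → ℝ)
    (hc : ∀ k, 0 < c k) (ha : ∀ k ∈ B, ∀ i ∈ J k, c k ≤ a i)
    (hb : ∀ k ∈ B, ∀ i ∈ J k, b i ≤ (1 / 2) ^ k)
    (hab : ∀ k ∈ B, ∀ i ∈ J k, 4 ^ k * b i ≤ a i) :
    ∃ I : Set ℕ, Summable (I.indicator b) ∧ ¬ Summable (I.indicator a) := by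
  classical
  have hS : ∀ k, ∃ S : Finset ℕ, (∀ i ∈ S, κ i = k) ∧ (k ∈ B → 1 ≤ ∑ i ∈ S, a i) ∧
      ∑ i ∈ S, b i ≤ 2 * (1 / 2) ^ k := by
    intro k
    by_cases hk : k ∈ B
    · have hK : (1 : ℝ) ≤ 4 ^ k * (1 / 2) ^ k := by
        rw [← mul_pow]; exact one_le_pow₀ (by norm_num)
      obtain ⟨S, hSJ, h1, h2⟩ := exists_finset_sum_bounds (hJ k hk) (hc k)
        (by positivity) hK (ha k hk) (hb k hk) (hab k hk)
      exact ⟨S, fun i hi => hJκ k hk i (hSJ hi), fun _ => h1, h2⟩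
    · exact ⟨∅, by simp, fun h => absurd h hk, by simp⟩
  choose S hSκ hSa hSb using hS
  have hfib : ∀ (f : ℕ → ℝ) (k : ℕ), HasSum (fun i : (κ ⁻¹' {k} : Set ℕ) =>
      indicator {i | i ∈ S (κ i)} f i) (∑ i ∈ S k, f i) := by
    intro f k
    refine (hasSum_subtype_iff_indicator (f := indicator {i | i ∈ S (κ i)} f)).2 ?_
    have h : (κ ⁻¹' {k}).indicator (indicator {i | i ∈ S (κ i)} f) =
        indicator (S k : Set ℕ) f := by
      rw [indicator_indicator]
      congr 1
      ext i
      constructor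
      · rintro ⟨rfl, h⟩
        exact h
      · intro h
        have hk := hSκ k i h
        exact ⟨hk, by simpa [hk] using h⟩
    rw [h]
    exact (hasSum_subtype_iff_indicator (f := f)).1 (Finset.hasSum (S k) f)
  have hpart : ∀ f : ℕ → ℝ, (∀ i, 0 ≤ f i) →
      (Summable (indicator {i | i ∈ S (κ i)} f) ↔ Summable fun k => ∑ i ∈ S k, f i) := by
    intro f hf
    rw [summable_partition (fun i => indicator_nonneg (fun i _ => hf i) i)
      (existsUnique_mem_fiber κ)]
    simp only [(hfib f _).tsum_eq, (hfib f _).summable, implies_true, true_and]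
  refine ⟨{i | i ∈ S (κ i)}, (hpart b hb0).2 ?_, fun h => ?_⟩
  · exact Summable.of_nonneg_of_le (fun k => Finset.sum_nonneg fun i _ => hb0 i) hSb
      (summable_geometric_two.mul_left 2)
  -- The fiber sums of `a` are at least 1 for infinitely many `k`, so they cannot tend to zero.
  · have ht := ((hpart a ha0).1 h).tendsto_atTop_zero
    obtain ⟨k₀, hk₀⟩ := eventually_atTop.1 (ht.eventually (gt_mem_nhds one_pos))
    obtain ⟨k, hkB, hk⟩ := hB.exists_gt k₀
    exact absurd (hSa k hkB) (not_le.2 (hk₀ k hk.le))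

/-- Two nonnegative sequences whose sums converge along the same sets of indices cannot have
ratios that are unboundedly distorted along infinite fibers. -/
lemma false_of_distorted_ratios (κ : ℕ → ℕ) (hκ : ∀ k, (κ ⁻¹' {k}).Infinite) {d D : ℕ → ℝ}
    (hD0 : ∀ i, 0 ≤ D i) (c : ℕ → ℝ) (hc : ∀ k, 0 < c k) (hcd : ∀ i, c (κ i) ≤ d i)
    (hd : ∀ i, d i ≤ (1 / 2) ^ κ i)
    (hdist : ∀ i, 4 ^ κ i * d i ≤ D i ∨ 4 ^ κ i * D i ≤ d i)
    (h : ∀ I : Set ℕ, Summable (I.indicator d) ↔ Summable (I.indicator D)) : False := by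
  have hd0 : ∀ i, 0 ≤ d i := fun i => (hc _).le.trans (hcd i)
  have hone : ∀ k : ℕ, (1 : ℝ) ≤ 4 ^ k := fun k => one_le_pow₀ (by norm_num)
  -- Pigeonhole twice: one direction of distortion occurs infinitely often in each fiber, and one
  -- direction does so for infinitely many fibers.
  have hsplit : ∀ k, (κ ⁻¹' {k} ∩ {i | 4 ^ κ i * d i ≤ D i}).Infinite ∨
      (κ ⁻¹' {k} ∩ {i | 4 ^ κ i * D i ≤ d i}).Infinite := by
    intro k
    rw [← infinite_union, ← inter_union_distrib_left]
    refine (hκ k).mono fun i hi => ⟨hi, hdist i⟩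
  have hsplit' : {k | (κ ⁻¹' {k} ∩ {i | 4 ^ κ i * d i ≤ D i}).Infinite}.Infinite ∨
      {k | (κ ⁻¹' {k} ∩ {i | 4 ^ κ i * D i ≤ d i}).Infinite}.Infinite := by
    rw [← infinite_union]
    exact infinite_univ.mono fun k _ => hsplit k
  rcases hsplit' with hB | hB
  · have ha : ∀ i, 4 ^ κ i * d i ≤ D i → c (κ i) ≤ D i := fun i hi => by
      nlinarith [hcd i, hd0 i, hone (κ i)]
    obtain ⟨I, h1, h2⟩ := exists_set_summable_not_summable κ hD0 hd0 hB
      (fun k => κ ⁻¹' {k} ∩ {i | 4 ^ κ i * d i ≤ D i}) (fun k _ i hi => hi.1) (fun k hk => hk)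
      c hc (by rintro k - i ⟨rfl, hi⟩; exact ha i hi) (by rintro k - i ⟨rfl, -⟩; exact hd i)
      (by rintro k - i ⟨rfl, hi⟩; exact hi)
    exact h2 ((h I).1 h1)
  · have hb : ∀ i, 4 ^ κ i * D i ≤ d i → D i ≤ (1 / 2) ^ κ i := fun i hi => by
      nlinarith [hd i, hD0 i, hone (κ i)]
    obtain ⟨I, h1, h2⟩ := exists_set_summable_not_summable κ hd0 hD0 hB
      (fun k => κ ⁻¹' {k} ∩ {i | 4 ^ κ i * D i ≤ d i}) (fun k _ i hi => hi.1) (fun k hk => hk)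
      c hc (by rintro k - i ⟨rfl, -⟩; exact hcd i) (by rintro k - i ⟨rfl, hi⟩; exact hb i hi)
      (by rintro k - i ⟨rfl, hi⟩; exact hi)
    exact h2 ((h I).2 h1)

/-! ### Block sums, finitely supported sequences and quantitative failure of embeddability. -/

lemma exists_extend_of_injective {Z : ℕ → Type*} {n : ℕ → ℕ} (hn : Function.Injective n)
    (u : ∀ i, Z (n i)) (g : ∀ m, Z m) :
    ∃ w : ∀ m, Z m, (∀ i, w (n i) = u i) ∧ ∀ m, m ∉ range n → w m = g m := by
  have h : ∀ m, ∃ z : Z m, (∀ i (hi : n i = m), hi ▸ u i = z) ∧ (m ∉ range n → z = g m) := by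
    intro m
    by_cases hm : m ∈ range n
    · obtain ⟨i, rfl⟩ := hm
      refine ⟨u i, fun j hj => ?_, fun h => absurd ⟨i, rfl⟩ h⟩
      obtain rfl := hn hj
      rfl
    · exact ⟨g m, fun i hi => absurd ⟨i, hi⟩ hm, fun _ => rfl⟩
  choose w hw hwg using h
  exact ⟨w, fun i => (hw (n i) i rfl).symm, hwg⟩

/-- Summability of a nonnegative sequence can be tested on the sums over consecutive blocks. -/
lemma summable_iff_summable_sum_Ico {l : ℕ → ℕ} (hl : StrictMono l) (hl0 : l 0 = 0)
    {f : ℕ → ℝ} (hf : ∀ k, 0 ≤ f k) :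
    Summable f ↔ Summable fun i => ∑ k ∈ Finset.Ico (l i) (l (i + 1)), f k := by
  have hu : ∀ k, ∃! i, k ∈ (Finset.Ico (l i) (l (i + 1)) : Set ℕ) := by
    intro k
    have hex : ∃ i, k < l (i + 1) := ⟨k, hl.id_le (k + 1)⟩
    classical
    refine ⟨Nat.find hex, ?_, fun j hj => ?_⟩
    · simp only [Finset.coe_Ico, mem_Ico]
      refine ⟨?_, Nat.find_spec hex⟩
      rcases h : Nat.find hex with _ | i
      · simp [hl0]
      · exact not_lt.1 (Nat.find_min hex (m := i) (by omega))
    · simp only [Finset.coe_Ico, mem_Ico] at hj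
      refine le_antisymm ?_ (Nat.find_min' hex hj.2)
      by_contra h
      have h1 : Nat.find hex + 1 ≤ j := by omega
      have := hl.monotone h1
      have := Nat.find_spec hex
      omega
  rw [summable_partition hf hu]
  have : ∀ i, Summable fun k : (Finset.Ico (l i) (l (i + 1)) : Set ℕ) => f k := fun i =>
    (Finset.hasSum _ f).summable
  simp only [this, implies_true, true_and]
  exact summable_congr fun i => Finset.tsum_subtype _ f

lemma summable_sum_dist_rpow_trans {Y : Type*} [PseudoMetricSpace Y] {q : ℝ} (hq : 0 ≤ q)
    {s : ℕ → Finset ℕ} {f g h : ℕ → ℕ → Y}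
    (hfg : Summable fun i => ∑ k ∈ s i, dist (f i k) (g i k) ^ q)
    (hgh : Summable fun i => ∑ k ∈ s i, dist (g i k) (h i k) ^ q) :
    Summable fun i => ∑ k ∈ s i, dist (f i k) (h i k) ^ q := by
  refine Summable.of_nonneg_of_le (fun i => Finset.sum_nonneg fun _ _ => by positivity)
    (fun i => ?_) ((hfg.add hgh).mul_left (2 ^ q))
  rw [← Finset.sum_add_distrib, Finset.mul_sum]
  exact Finset.sum_le_sum fun k _ => dist_rpow_le_two_rpow_mul_add hq _ _ _

lemma EllSpace.hasSum_dist_rpow {q : ℝ} [hq : Fact (1 ≤ q)] {Y : Type*} [NormedAddCommGroup Y]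
    (f g : EllSpace q Y) : HasSum (fun k => dist (f k) (g k) ^ q) (dist f g ^ q) := by
  have hq0 : 0 ≤ q := by linarith [hq.out]
  have hq1 : 0 < q := by linarith [hq.out]
  have h := lp.hasSum_norm (p := ENNReal.ofReal q) (by rwa [ENNReal.toReal_ofReal hq0]) (f - g)
  simpa only [ENNReal.toReal_ofReal hq0, dist_eq_norm, lp.coeFn_sub, Pi.sub_apply] using h

/-- The element of `ℓ_q(Y)` that equals `f` on `s` and vanishes off `s`. -/
noncomputable def EllSpace.ofFinset (q : ℝ) {Y : Type*} [NormedAddCommGroup Y] (s : Finset ℕ)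
    (f : ℕ → Y) : EllSpace q Y :=
  ⟨(s : Set ℕ).indicator f, (memℓp_zero (s.finite_toSet.subset fun i hi => by
    by_contra h
    exact hi (indicator_of_notMem h f))).of_exponent_ge zero_le⟩

lemma EllSpace.dist_ofFinset_rpow {q : ℝ} [hq : Fact (1 ≤ q)] {Y : Type*}
    [NormedAddCommGroup Y] (s : Finset ℕ) (f g : ℕ → Y) :
    dist (EllSpace.ofFinset q s f) (EllSpace.ofFinset q s g) ^ q =
      ∑ k ∈ s, dist (f k) (g k) ^ q := by
  have hq0 : q ≠ 0 := by linarith [hq.out]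
  refine (EllSpace.hasSum_dist_rpow _ _).unique ?_
  have h : (fun k => dist (EllSpace.ofFinset q s f k) (EllSpace.ofFinset q s g k) ^ q) =
      (s : Set ℕ).indicator fun k => dist (f k) (g k) ^ q := by
    funext k
    by_cases hk : k ∈ (s : Set ℕ)
    · simp only [EllSpace.ofFinset, indicator_of_mem hk]
    · simp only [EllSpace.ofFinset, indicator_of_notMem hk, dist_self, Real.zero_rpow hq0]
  rw [h]
  exact (hasSum_subtype_iff_indicator (f := fun k => dist (f k) (g k) ^ q)).1 (Finset.hasSum s _)

/-- Scaling makes the finite sets that witness a failure of Hölder embeddability small. -/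
lemma exists_small_finset_of_not_finitelyHolderEmbeds (𝕜 : Type*) {X W : Type*} [RCLike 𝕜]
    [NormedAddCommGroup X] [NormedSpace 𝕜 X] [NormedAddCommGroup W] [NormedSpace 𝕜 W] {α : ℝ}
    (h : ¬ FinitelyHolderEmbeds X W α) {A δ : ℝ} (hA : 0 < A) (hδ : 0 < δ) :
    ∃ F : Finset X, (∀ u v : F, dist u v ≤ δ) ∧ ∀ T : F → W, ∃ u v : F,
      ¬ (1 / A * dist u v ^ α ≤ dist (T u) (T v) ∧ dist (T u) (T v) ≤ A * dist u v ^ α) := by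
  classical
  -- Multiplying the domain by `t` and the target by `t ^ α` preserves the Hölder bounds with the
  -- same constant, so a bad set may be shrunk to any diameter.
  unfold FinitelyHolderEmbeds at h
  push Not at h
  obtain ⟨F₀, hF₀⟩ := h A hA
  obtain ⟨C, hC⟩ := Metric.isBounded_iff.1 F₀.finite_toSet.isBounded
  set t : ℝ := δ / (|C| + 1) with ht
  have hC1 : 0 < |C| + 1 := by positivity
  have ht0 : 0 < t := by positivity
  have hdist : ∀ u v : X, dist ((t : 𝕜) • u) ((t : 𝕜) • v) = t * dist u v := fun u v => by
    rw [dist_smul₀, RCLike.norm_ofReal, abs_of_pos ht0]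
  refine ⟨F₀.image fun u => (t : 𝕜) • u, ?_, fun T => ?_⟩
  · rintro ⟨u, hu⟩ ⟨v, hv⟩
    obtain ⟨u, hu', rfl⟩ := Finset.mem_image.1 hu
    obtain ⟨v, hv', rfl⟩ := Finset.mem_image.1 hv
    rw [Subtype.dist_eq, hdist]
    calc t * dist u v ≤ t * (|C| + 1) := by
          gcongr
          linarith [hC hu' hv', le_abs_self C]
      _ = δ := div_mul_cancel₀ _ hC1.ne'
  · by_contra! hT
    have htα : 0 < t ^ α := Real.rpow_pos_of_pos ht0 α
    let e : F₀ → F₀.image fun u => (t : 𝕜) • u := fun u =>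
      ⟨(t : 𝕜) • (u : X), Finset.mem_image_of_mem _ u.2⟩
    obtain ⟨u, v, huv⟩ := hF₀ fun u => (((t ^ α)⁻¹ : ℝ) : 𝕜) • T (e u)
    obtain ⟨h1, h2⟩ := hT (e u) (e v)
    have he : dist (e u) (e v) ^ α = t ^ α * dist u v ^ α := by
      rw [Subtype.dist_eq, hdist, Real.mul_rpow ht0.le dist_nonneg, Subtype.dist_eq]
    rw [he] at h1 h2
    have hd : dist ((((t ^ α)⁻¹ : ℝ) : 𝕜) • T (e u)) ((((t ^ α)⁻¹ : ℝ) : 𝕜) • T (e v)) =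
        (t ^ α)⁻¹ * dist (T (e u)) (T (e v)) := by
      rw [dist_smul₀, RCLike.norm_ofReal, abs_of_pos (inv_pos.2 htα)]
    rw [hd] at huv
    refine absurd (huv ?_) (not_lt.2 ?_)
    · rw [inv_mul_eq_div, le_div_iff₀ htα]
      linarith
    · rw [inv_mul_eq_div, div_le_iff₀ htα]
      linarith

/-- Raising the violated bound to the power `q` gives the factor `A ^ q`, which is at least `A`. -/
lemma distorted_rpow_of_not_holder {p q A s t : ℝ} (hq : 1 ≤ q) (hA : 1 ≤ A) (hs : 0 ≤ s)
    (ht : 0 ≤ t) (h : ¬ (1 / A * s ^ (p / q) ≤ t ∧ t ≤ A * s ^ (p / q))) :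
    A * s ^ p ≤ t ^ q ∨ A * t ^ q ≤ s ^ p := by
  have hq0 : 0 < q := by linarith
  have hA0 : 0 < A := by linarith
  have hAq : A ≤ A ^ q := by
    simpa using Real.rpow_le_rpow_of_exponent_le hA hq
  have hsp : (s ^ (p / q)) ^ q = s ^ p := by
    rw [← Real.rpow_mul hs, div_mul_cancel₀ _ hq0.ne']
  rcases not_and_or.1 h with h | h
  · right
    have h1 : A * t ≤ s ^ (p / q) := by
      rw [not_le, one_div, inv_mul_eq_div, lt_div_iff₀ hA0] at h
      linarith
    calc A * t ^ q ≤ A ^ q * t ^ q := by gcongr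
      _ = (A * t) ^ q := (Real.mul_rpow hA0.le ht).symm
      _ ≤ (s ^ (p / q)) ^ q := by gcongr
      _ = s ^ p := hsp
  · left
    calc A * s ^ p ≤ A ^ q * s ^ p := by gcongr
      _ = (A * s ^ (p / q)) ^ q := by rw [Real.mul_rpow hA0.le (by positivity), hsp]
      _ ≤ t ^ q := by
        have := (not_le.1 h).le
        gcongr

lemma exists_pos_le_dist_rpow {X : Type*} [MetricSpace X] (F : Finset X) (p : ℝ) :
    ∃ c : ℝ, 0 < c ∧ ∀ u v : F, u ≠ v → c ≤ dist u v ^ p := by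
  have h : ∀ᶠ c in 𝓝[>] (0 : ℝ), ∀ u v : F, u ≠ v → c ≤ dist u v ^ p := by
    refine eventually_all.2 fun u => eventually_all.2 fun v => ?_
    by_cases huv : u = v
    · exact Eventually.of_forall fun _ h => absurd huv h
    · have : 0 < dist u v ^ p := Real.rpow_pos_of_pos (dist_pos.2 huv) p
      filter_upwards [mem_nhdsWithin_of_mem_nhds (Iic_mem_nhds this)] with c hc _ using hc
  obtain ⟨c, hc, hc0⟩ := (h.and self_mem_nhdsWithin).exists
  exact ⟨c, hc0, hc⟩

/-! ### The two implications. -/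

theorem finitelyHolderEmbeds_of_borelReducible (𝕜 : Type*) {X Y : Type*} [RCLike 𝕜]
    [NormedAddCommGroup X] [NormedSpace 𝕜 X]
    [NormedAddCommGroup Y] [NormedSpace 𝕜 Y] [SeparableSpace Y]
    (p q : ℝ) [hp : Fact (1 ≤ p)] [hq : Fact (1 ≤ q)]
    (hred : ∀ F : ℕ → Finset X,
      BorelReducible (seqEquiv (fun n => F n) p) (seqEquiv (fun _ => Y) q)) :
    FinitelyHolderEmbeds X (EllSpace q Y) (p / q) := by
  classical
  by_contra hemb
  have hp1 : 1 ≤ p := hp.out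
  have hq1 : 1 ≤ q := hq.out
  have hp0 : p ≠ 0 := by linarith
  have hq0 : 0 < q := by linarith
  choose G hGsmall hG using fun k : ℕ => exists_small_finset_of_not_finitelyHolderEmbeds 𝕜 hemb
    (show (0 : ℝ) < 4 ^ k by positivity) (show (0 : ℝ) < (1 / 2) ^ k by positivity)
  -- Every `G k` occurs at infinitely many coordinates. It is nonempty, since even the zero map must
  -- fail at some pair of its points.
  let F : ℕ → Finset X := fun n => G n.unpair.1
  have hne : ∀ n, Nonempty (F n) := fun n => ⟨(hG n.unpair.1 fun _ => 0).choose⟩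
  obtain ⟨θ, hθ, hθE⟩ := hred F
  replace hθE : ∀ x y : ∀ n, F n, (Summable fun n => dist (x n) (y n) ^ p) ↔
      Summable fun k => dist (θ x k) (θ y k) ^ q := hθE
  let : MeasurableSpace (∀ n, F n) := borel _
  have : BorelSpace (∀ n, F n) := ⟨rfl⟩
  let : MeasurableSpace Y := borel Y
  have : BorelSpace Y := ⟨rfl⟩
  have : SecondCountableTopology Y := UniformSpace.secondCountable_of_separable Y
  have hθm : ∀ k, Measurable fun x => θ x k := fun k =>
    (continuous_apply (A := fun _ : ℕ => Y) k).borel_measurable.comp hθ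
  obtain ⟨g, n, l, hn, hl, hl0, hτ, hK⟩ := exists_free_coordinates hq0 θ hθm
    (fun x y ⟨m, hm⟩ => (hθE x y).1 <| summable_of_ne_finset_zero (s := Finset.range m)
      fun k hk => by
        rw [hm k (by simpa using hk), dist_self, Real.zero_rpow hp0])
    -- The `i`-th free coordinate must carry the set `G i.unpair.1`, so each `G k` also occurs at
    -- infinitely many free coordinates.
    (fun i m => m.unpair.1 = i.unpair.1)
    (fun i M => ⟨Nat.pair i.unpair.1 M, Nat.right_le_pair _ _, by simp⟩)
  let s : ℕ → Finset ℕ := fun i => Finset.Ico (l i) (l (i + 1))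
  let T : ∀ i, F (n i) → ℕ → Y := fun i u => θ (Function.update g (n i) u)
  choose u v huv using fun i => hG (n i).unpair.1 fun u => EllSpace.ofFinset q (s i) (T i u)
  replace hK : ∀ x : ∀ n, F n, (∀ m, m ∉ range n → x m = g m) →
      Summable fun i => ∑ k ∈ s i, dist (θ x k) (T i (x (n i)) k) ^ q := hK
  have hne' : ∀ i, u i ≠ v i := by
    intro i h
    refine huv i ?_
    have : p / q ≠ 0 := div_ne_zero hp0 hq0.ne'
    simp [h, Real.zero_rpow this]
  choose c hc hcd using fun k => exists_pos_le_dist_rpow (G k) p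
  -- The errors in `hK` are summable, so by the triangle inequality `θ x` and `θ y` may be replaced
  -- blockwise by the one-coordinate maps `T i`.
  have hequiv : ∀ x y : ∀ n, F n, (∀ m, m ∉ range n → x m = g m) →
      (∀ m, m ∉ range n → y m = g m) →
      ((Summable fun i => dist (x (n i)) (y (n i)) ^ p) ↔
        Summable fun i => ∑ k ∈ s i, dist (T i (x (n i)) k) (T i (y (n i)) k) ^ q) := by
    intro x y hx hy
    have h1 : (Summable fun i => dist (x (n i)) (y (n i)) ^ p) ↔
        Summable fun m => dist (x m) (y m) ^ p :=
      hn.injective.summable_iff (f := fun m => dist (x m) (y m) ^ p) fun m hm => by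
        rw [hx m hm, hy m hm, dist_self, Real.zero_rpow hp0]
    rw [h1, hθE, summable_iff_summable_sum_Ico hl hl0 fun k => by positivity]
    have hxs := hK x hx
    have hys := hK y hy
    constructor
    · intro h
      refine summable_sum_dist_rpow_trans hq0.le (g := fun _ => θ x) ?_
        (summable_sum_dist_rpow_trans hq0.le (g := fun _ => θ y) h hys)
      simpa only [dist_comm] using hxs
    · intro h
      refine summable_sum_dist_rpow_trans hq0.le (s := s) (f := fun _ => θ x)
        (h := fun _ => θ y) (g := fun i => T i (x (n i))) hxs
        (summable_sum_dist_rpow_trans hq0.le (g := fun i => T i (y (n i))) h ?_)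
      simpa only [dist_comm] using hys
  have hfib : ∀ k, ((fun i => (n i).unpair.1) ⁻¹' {k}).Infinite := by
    intro k
    refine (infinite_range_of_injective (f := Nat.pair k) fun a b h => ?_).mono ?_
    · simpa using h
    · rintro _ ⟨j, rfl⟩
      simpa using hτ (Nat.pair k j)
  refine false_of_distorted_ratios (fun i => (n i).unpair.1) hfib
    (d := fun i => dist (u i) (v i) ^ p)
    (D := fun i => ∑ k ∈ s i, dist (T i (u i) k) (T i (v i) k) ^ q)
    (fun i => Finset.sum_nonneg fun _ _ => by positivity) c hc
    (fun i => hcd _ _ _ (hne' i)) (fun i => ?_) (fun i => ?_) fun I => ?_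
  · have h1 := hGsmall _ (u i) (v i)
    have h2 : dist (u i) (v i) ≤ 1 := h1.trans (pow_le_one₀ (by norm_num) (by norm_num))
    refine le_trans ?_ h1
    simpa using Real.rpow_le_rpow_of_exponent_ge (dist_pos.2 (hne' i)) h2 hp1
  · rw [← EllSpace.dist_ofFinset_rpow]
    exact distorted_rpow_of_not_holder hq1 (one_le_pow₀ (by norm_num)) dist_nonneg dist_nonneg
      (huv i)
  -- The test points take the values `u i` and `v i` for `i ∈ I` and agree with `g` elsewhere, so
  -- only the indices in `I` contribute.
  · obtain ⟨x, hx, hxg⟩ := exists_extend_of_injective (Z := fun m => F m) hn.injective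
      (fun i => if i ∈ I then u i else g (n i)) g
    obtain ⟨y, hy, hyg⟩ := exists_extend_of_injective (Z := fun m => F m) hn.injective
      (fun i => if i ∈ I then v i else g (n i)) g
    have h := hequiv x y hxg hyg
    simp only [hx, hy] at h
    convert h using 2
    · funext i
      by_cases hi : i ∈ I
      · simp [hi]
      · simp [hi, Real.zero_rpow hp0]
    · funext i
      by_cases hi : i ∈ I
      · simp [hi]
      · simp [hi, Real.zero_rpow hq0.ne']

theorem borelReducible_of_finitelyHolderEmbeds {X Y : Type*} [MetricSpace X]
    [NormedAddCommGroup Y] (p q : ℝ) [hp : Fact (1 ≤ p)] [hq : Fact (1 ≤ q)]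
    (h : FinitelyHolderEmbeds X (EllSpace q Y) (p / q)) (F : ℕ → Finset X) :
    BorelReducible (seqEquiv (fun n => F n) p) (seqEquiv (fun _ => Y) q) := by
  have hq0 : 0 < q := by linarith [hq.out]
  obtain ⟨A, hA, hT⟩ := h
  choose T hT using fun n => hT (F n)
  -- The index `k` codes a pair (which `T n`, which term of its value); each term depends on one
  -- coordinate in a finite discrete space, whence continuity.
  let θ : (∀ n, F n) → ℕ → Y := fun x k => T k.unpair.1 (x k.unpair.1) k.unpair.2
  have hθ : Continuous θ := continuous_pi fun k =>
    (continuous_of_discreteTopology (f := fun u => T k.unpair.1 u k.unpair.2)).comp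
      (continuous_apply k.unpair.1)
  refine ⟨θ, hθ.borel_measurable, fun x y => ?_⟩
  change (Summable fun n => dist (x n) (y n) ^ p) ↔
    Summable fun k => dist (θ x k) (θ y k) ^ q
  have h1 : (Summable fun k => dist (θ x k) (θ y k) ^ q) ↔
      Summable fun c : ℕ × ℕ => dist (T c.1 (x c.1) c.2) (T c.1 (y c.1) c.2) ^ q :=
    Nat.pairEquiv.symm.summable_iff
      (f := fun c : ℕ × ℕ => dist (T c.1 (x c.1) c.2) (T c.1 (y c.1) c.2) ^ q)
  have hsum := fun n => EllSpace.hasSum_dist_rpow (T n (x n)) (T n (y n))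
  have hpow : ∀ n, (dist (x n) (y n) ^ (p / q)) ^ q = dist (x n) (y n) ^ p := fun n => by
    rw [← Real.rpow_mul dist_nonneg, div_mul_cancel₀ _ hq0.ne']
  have hup : ∀ n, dist (T n (x n)) (T n (y n)) ^ q ≤ A ^ q * dist (x n) (y n) ^ p := fun n => by
    rw [← hpow, ← Real.mul_rpow hA.le (by positivity)]
    exact Real.rpow_le_rpow dist_nonneg (hT n _ _).2 hq0.le
  have hlow : ∀ n, dist (x n) (y n) ^ p ≤ A ^ q * dist (T n (x n)) (T n (y n)) ^ q := fun n => by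
    rw [← hpow, ← Real.mul_rpow hA.le dist_nonneg]
    refine Real.rpow_le_rpow (by positivity) ?_ hq0.le
    have := (hT n (x n) (y n)).1
    rwa [one_div, inv_mul_le_iff₀ hA] at this
  rw [h1, summable_prod_of_nonneg fun c => by positivity]
  simp only [(hsum _).summable, (hsum _).tsum_eq, implies_true, true_and]
  exact ⟨fun h => Summable.of_nonneg_of_le (fun n => by positivity) hup (h.mul_left _),
    fun h => Summable.of_nonneg_of_le (fun n => by positivity) hlow (h.mul_left _)⟩

theorem BorelReducible.restrict_finset {X Y : Type*} [MetricSpace X] [MetricSpace Y] {p q : ℝ}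
    [Fact (1 ≤ p)] [Fact (1 ≤ q)]
    (h : BorelReducible (seqEquiv (fun _ => X) p) (seqEquiv (fun _ => Y) q))
    (F : ℕ → Finset X) :
    BorelReducible (seqEquiv (fun n => F n) p) (seqEquiv (fun _ => Y) q) := by
  obtain ⟨θ, hθ, hθE⟩ := h
  have hc : Continuous fun (x : ∀ n, F n) (n : ℕ) => (x n : X) :=
    continuous_pi fun n => continuous_subtype_val.comp (continuous_apply n)
  exact ⟨fun x => θ fun n => x n, hθ.comp hc.borel_measurable,
    fun x y => hθE (fun n => x n) fun n => y n⟩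

theorem mainTheorem2 {𝕜 X Y : Type*} [RCLike 𝕜]
    [NormedAddCommGroup X] [NormedSpace 𝕜 X] [CompleteSpace X] [TopologicalSpace.SeparableSpace X]
    [NormedAddCommGroup Y] [NormedSpace 𝕜 Y] [CompleteSpace Y] [TopologicalSpace.SeparableSpace Y]
    (p q : ℝ) [Fact (1 ≤ p)] [Fact (1 ≤ q)] :
    (FinitelyHolderEmbeds X (EllSpace q Y) (p / q) ↔
      ∀ F : ℕ → Finset X,
        BorelReducible (seqEquiv (fun n => F n) p) (seqEquiv (fun _ => Y) q)) ∧
    (BorelReducible (seqEquiv (fun _ => X) p) (seqEquiv (fun _ => Y) q) →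
      FinitelyHolderEmbeds X (EllSpace q Y) (p / q)) :=
  ⟨⟨borelReducible_of_finitelyHolderEmbeds p q, finitelyHolderEmbeds_of_borelReducible 𝕜 p q⟩,
    fun h => finitelyHolderEmbeds_of_borelReducible 𝕜 p q h.restrict_finset⟩
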